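/- For $r\in(0,1)$ let $r'=\sqrt{1-r^2}$ and let $$\mathcal E(r)=\int_0^{\pi/2}\sqrt{1-r^2\sin^2\theta}\,d\theta$$ be the complete elliptic integral of the second kind. For $a,b>0$ let $$T(a,b)=\frac{2}{\pi}\int_0^{\pi/2}\sqrt{a^2\cos^2\theta+b^2\sin^2\theta}\,d\theta,\qquad A(a,b)=\frac{a+b}{2},\qquad C(a,b)=\frac{a^2+b^2}{a+b}$$ be the Toader, arithmetic and contraharmonic means. For real $p,t$ put $$B_{p,t}(r)=2^{p-2}\pi(1+r')^{1-2p}\left\{[t+(1-t)r']^2+[(1-t)+tr']^2\right\}^p,$$ $$Q_{p,t}(a,b)=C\bigl(ta+(1-t)b,\;tb+(1-t)a\bigr)^p\,A(a,b)^{1-p}.$$ **Theorem 1.2.** Let $t_1,t_2\in[1/2,1]$ and $p\in[1/2,2]$. Then: 1. $B_{p,t_1}(r)<\mathcal E(r)$ holds for all $r\in(0,1)$ if and only if $t_1\le \frac12+\frac12\sqrt{\frac1{4p}}$; 2. $\mathcal E(r)<B_{p,t_2}(r)$ holds for all $r\in(0,1)$ if and only if $t_2\ge \frac12+\frac12\sqrt{(4/\pi)^{1/p}-1}$;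 3. the double inequality $B_{p,t_1}(r)<\mathcal E(r)<B_{p,t_2}(r)$ holds for all $r\in(0,1)$ if and only if $t_1\le \frac12+\frac12\sqrt{\frac1{4p}}$ and $t_2\ge \frac12+\frac12\sqrt{(4/\pi)^{1/p}-1}$. Equivalently, in terms of the Toader mean: 4. $Q_{p,t_1}(a,b)<T(a,b)$ holds for all $a,b>0$ with $a\ne b$ if and only if $t_1\le \frac12+\frac12\sqrt{\frac1{4p}}$; 5. $T(a,b)<Q_{p,t_2}(a,b)$ holds for all $a,b>0$ with $a\ne b$ if and only if $t_2\ge \frac12+\frac12\sqrt{(4/\pi)^{1/p}-1}$; 6. the double inequality $Q_{p,t_1}(a,b)<T(a,b)<Q_{p,t_2}(a,b)$ holds for all $a,b>0$ with $a\ne b$ if and only if $t_1\le \frac12+\frac12\sqrt{\frac1{4p}}$ and $t_2\ge \frac12+\frac12\sqrt{(4/\pi)^{1/p}-1}$. -/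

import Mathlib

/-- The complete elliptic integral of the second kind,
`∫ θ in 0..π/2, (1 - r² sin² θ)^(1/2)`, as a function of the modulus `r`. -/
noncomputable def ellipticE (r : ℝ) : ℝ :=
  ∫ θ in (0 : ℝ)..(Real.pi / 2), Real.sqrt (1 - r ^ 2 * Real.sin θ ^ 2)

/-- The Toader mean `T(a, b)` of two positive numbers. -/
noncomputable def toaderMean (a b : ℝ) : ℝ :=
  2 / Real.pi *
    ∫ θ in (0 : ℝ)..(Real.pi / 2),
      Real.sqrt (a ^ 2 * Real.cos θ ^ 2 + b ^ 2 * Real.sin θ ^ 2)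

/-- The arithmetic mean `A(a, b)`. -/
noncomputable def arithMean (a b : ℝ) : ℝ := (a + b) / 2

/-- The contraharmonic mean `C(a, b)` of two positive numbers. -/
noncomputable def contraharmonicMean (a b : ℝ) : ℝ := (a ^ 2 + b ^ 2) / (a + b)

/-- The complementary modulus `r' = √(1 - r²)`. -/
noncomputable def complModulus (r : ℝ) : ℝ := Real.sqrt (1 - r ^ 2)

/-- The bounding function
`2^(p-2) π (1 + r')^(1-2p) {[t + (1-t) r']² + [(1-t) + t r']²}^p`. -/
noncomputable def ellipticBound (p t r : ℝ) : ℝ :=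
  (2 : ℝ) ^ (p - 2) * Real.pi * (1 + complModulus r) ^ (1 - 2 * p) *
    ((t + (1 - t) * complModulus r) ^ 2 + ((1 - t) + t * complModulus r) ^ 2) ^ p

/-- The mean `C^p(t a + (1-t) b, t b + (1-t) a) · A^(1-p)(a, b)`. -/
noncomputable def toaderBound (p t a b : ℝ) : ℝ :=
  contraharmonicMean (t * a + (1 - t) * b) (t * b + (1 - t) * a) ^ p *
    arithMean a b ^ (1 - p)

/-!
By homogeneity and symmetry it suffices to treat the pairs `(1 + v, 1 - v)` with `0 < v < 1`, for
which the bounding mean is `(1 + u v²) ^ p` with `u = (2 t - 1)²`. The elliptic integral is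
`π / 2` times the Toader mean of `1` and `r'`, and its bound is the same multiple of the bounding
mean, so that the two halves of the theorem say the same thing (`forall_elliptic_iff`).

Integrating `|(1 + v e^{2iθ})^(1/2)|²` termwise gives the Gauss-Kummer series
`T(1 + v, 1 - v) = ∑ (1/2 choose n)² v^(2n)` (`hasSum_toaderMean`). Its first three terms are
`(1 + v² / 8)²`, its coefficients are nonnegative, and its value at `v = 1` is `4 / π`; hence
`(1 + v² / 8)² < T(1 + v, 1 - v) ≤ (1 + v² / 8)² + v⁶ (4 / π - 81 / 64)`.

For the lower bound, Bernoulli's inequality with exponent `p / 2 ≤ 1` gives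
`(1 + u v²) ^ p ≤ (1 + v² / 8)²` as soon as `u ≤ 1 / (4 p)`, and the expansion at `v = 0` shows
that this is necessary. For the upper bound, the estimate from above implies that
`√T(1 + v, 1 - v)`, as a function of `v²`, lies below its chord over `[0, 1]`; as `2 / p ≥ 1`, the
convexity of `w ↦ w ^ (2 / p)` carries this over to `T ^ (1 / p)`, whose chord has slope
`(4 / π) ^ (1 / p) - 1`. The limit `v → 1` shows that no smaller `u` will do.
-/

/-! ### The power series of the Toader mean -/

theorem choose_half_two : Ring.choose (1 / 2 : ℝ) 2 = -1 / 8 := by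
  rw [Ring.choose_eq_smul]
  simp [descPochhammer_succ_right, Polynomial.smeval_mul, Nat.factorial, Polynomial.smeval_sub]
  norm_num

theorem choose_half_three : Ring.choose (1 / 2 : ℝ) 3 = 1 / 16 := by
  rw [Ring.choose_eq_smul]
  simp [descPochhammer_succ_right, Polynomial.smeval_mul, Nat.factorial, Polynomial.smeval_sub,
    Polynomial.smeval_natCast, -Nat.cast_ofNat]
  norm_num

theorem hasSum_choose_half_mul_pow {z : ℂ} (hz : ‖z‖ < 1) :
    HasSum (fun n : ℕ ↦ ((Ring.choose (1 / 2 : ℝ) n : ℝ) : ℂ) * z ^ n) ((1 + z) ^ (1 / 2 : ℂ)) := by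
  have h := (Complex.one_add_cpow_hasFPowerSeriesOnBall_zero (a := 1 / 2)).hasSum (y := z)
    (by simpa [← ENNReal.ofReal_one, Metric.eball_ofReal] using hz)
  simp only [binomialSeries_apply, List.ofFn_const, List.prod_replicate, smul_eq_mul,
    zero_add] at h
  convert! h using 3 with n
  simp [Complex.ofReal_choose]

theorem summable_abs_choose_half_mul_pow {v : ℝ} (hv : v ∈ Set.Ico (0 : ℝ) 1) :
    Summable fun n : ℕ ↦ |Ring.choose (1 / 2 : ℝ) n| * v ^ n := by
  have h := (hasSum_choose_half_mul_pow (z := v)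
    (by simpa [abs_of_nonneg hv.1] using hv.2)).summable.norm
  simpa only [norm_mul, norm_pow, Complex.norm_real, Real.norm_eq_abs, abs_of_nonneg hv.1] using h

theorem norm_cpow_half_sq (v θ : ℝ) :
    ‖(1 + v * Complex.exp ((2 * θ : ℝ) * Complex.I)) ^ (1 / 2 : ℂ)‖ ^ 2 =
      Real.sqrt ((1 + v) ^ 2 * Real.cos θ ^ 2 + (1 - v) ^ 2 * Real.sin θ ^ 2) := by
  rw [← norm_pow, show (1 / 2 : ℂ) = ((2 : ℕ) : ℂ)⁻¹ by norm_num,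
    Complex.cpow_nat_inv_pow _ two_ne_zero, Complex.norm_def, Complex.normSq_apply]
  congr 1
  simp only [Complex.add_re, Complex.add_im, Complex.one_re, Complex.one_im, Complex.re_ofReal_mul,
    Complex.im_ofReal_mul, Complex.exp_ofReal_mul_I_re, Complex.exp_ofReal_mul_I_im]
  rw [Real.cos_two_mul, Real.sin_two_mul]
  linear_combination (4 * v ^ 2 * Real.cos θ ^ 2 - (1 - v) ^ 2) * Real.sin_sq_add_cos_sq θ

theorem re_mul_conj_polar (b c v θ : ℝ) (m n : ℕ) :
    ((b : ℂ) * (v * Complex.exp ((2 * θ : ℝ) * Complex.I)) ^ m *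
      (starRingEnd ℂ) ((c : ℂ) * (v * Complex.exp ((2 * θ : ℝ) * Complex.I)) ^ n)).re =
      b * v ^ m * (c * v ^ n) * Real.cos (2 * ((m : ℝ) - n) * θ) := by
  have hpow : ∀ k : ℕ, (v * Complex.exp ((2 * θ : ℝ) * Complex.I)) ^ k =
      ((v ^ k : ℝ) : ℂ) * Complex.exp ((2 * k * θ : ℝ) * Complex.I) := by
    intro k
    rw [mul_pow, ← Complex.exp_nat_mul]
    push_cast
    ring_nf
  have : (2 * ((m : ℝ) - n) * θ) = 2 * m * θ - 2 * n * θ := by ring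
  rw [hpow, hpow, this, Real.cos_sub]
  simp only [map_mul, Complex.conj_ofReal, Complex.mul_re, Complex.mul_im, Complex.ofReal_re,
    Complex.ofReal_im, Complex.conj_re, Complex.conj_im, Complex.exp_ofReal_mul_I_re,
    Complex.exp_ofReal_mul_I_im]
  ring

/-- On the circle `z = v e^{2iθ}` the modulus of `1 + z` is the square of the modulus of the
binomial series of `(1 + z)^(1/2)`, and so has an absolutely convergent double cosine series. -/
theorem hasSum_sqrt_integrand {v : ℝ} (hv : v ∈ Set.Ico (0 : ℝ) 1) (θ : ℝ) :
    HasSum (fun mn : ℕ × ℕ ↦ Ring.choose (1 / 2 : ℝ) mn.1 * v ^ mn.1 *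
        (Ring.choose (1 / 2 : ℝ) mn.2 * v ^ mn.2) * Real.cos (2 * ((mn.1 : ℝ) - mn.2) * θ))
      (Real.sqrt ((1 + v) ^ 2 * Real.cos θ ^ 2 + (1 - v) ^ 2 * Real.sin θ ^ 2)) := by
  have hz : ‖(v : ℂ) * Complex.exp ((2 * θ : ℝ) * Complex.I)‖ < 1 := by
    rw [norm_mul, Complex.norm_exp_ofReal_mul_I, mul_one, Complex.norm_real, Real.norm_eq_abs,
      abs_of_nonneg hv.1]
    exact hv.2
  have h1 := hasSum_choose_half_mul_pow hz
  generalize hF : (1 + (v : ℂ) * Complex.exp ((2 * θ : ℝ) * Complex.I)) ^ (1 / 2 : ℂ) = F at h1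
  have h2 := h1.map (starRingEnd ℂ) Complex.continuous_conj
  have hs := summable_mul_of_summable_norm h1.summable.norm h2.summable.norm
  have h3 := Complex.hasSum_re (h1.mul h2 hs)
  simp only [Function.comp_apply, re_mul_conj_polar] at h3
  rwa [Complex.mul_conj, Complex.ofReal_re, Complex.normSq_eq_norm_sq, ← hF,
    norm_cpow_half_sq] at h3

theorem integral_cos_two_mul_sub (m n : ℕ) :
    ∫ θ in (0 : ℝ)..(Real.pi / 2), Real.cos (2 * ((m : ℝ) - n) * θ) =
      if m = n then Real.pi / 2 else 0 := by
  split_ifs with h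
  · simp [h]
  · have hc : 2 * ((m : ℝ) - n) ≠ 0 :=
      mul_ne_zero two_ne_zero (sub_ne_zero.2 (Nat.cast_injective.ne h))
    rw [intervalIntegral.integral_comp_mul_left (fun x ↦ Real.cos x) hc, integral_cos]
    have : 2 * ((m : ℝ) - n) * (Real.pi / 2) = ((m - n : ℤ) : ℝ) * Real.pi := by
      push_cast; ring
    rw [this, Real.sin_int_mul_pi]
    simp

/-- The Gauss-Kummer series of the Toader mean of `1 + v` and `1 - v`: in the double cosine series
only the diagonal terms have a nonzero integral over `[0, π / 2]`. -/
theorem hasSum_toaderMean {v : ℝ} (hv : v ∈ Set.Ico (0 : ℝ) 1) :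
    HasSum (fun n : ℕ ↦ Ring.choose (1 / 2 : ℝ) n ^ 2 * (v ^ 2) ^ n)
      (toaderMean (1 + v) (1 - v)) := by
  have hs := summable_abs_choose_half_mul_pow hv
  have hb := hs.mul_of_nonneg hs
    (fun n ↦ mul_nonneg (abs_nonneg _) (pow_nonneg hv.1 n))
    (fun n ↦ mul_nonneg (abs_nonneg _) (pow_nonneg hv.1 n))
  have h := intervalIntegral.hasSum_integral_of_dominated_convergence
    (μ := MeasureTheory.volume) (a := 0) (b := Real.pi / 2)
    (F := fun (mn : ℕ × ℕ) (θ : ℝ) ↦ Ring.choose (1 / 2 : ℝ) mn.1 * v ^ mn.1 *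
        (Ring.choose (1 / 2 : ℝ) mn.2 * v ^ mn.2) * Real.cos (2 * ((mn.1 : ℝ) - mn.2) * θ))
    (fun mn _ ↦ |Ring.choose (1 / 2 : ℝ) mn.1| * v ^ mn.1 *
      (|Ring.choose (1 / 2 : ℝ) mn.2| * v ^ mn.2))
    (fun mn ↦ (by fun_prop : Continuous _).aestronglyMeasurable)
    (fun mn ↦ .of_forall fun θ _ ↦ by
      simp only [norm_mul, Real.norm_eq_abs, abs_pow, abs_of_nonneg hv.1]
      exact mul_le_of_le_one_right (by have := hv.1; positivity) (Real.abs_cos_le_one _))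
    (.of_forall fun _ _ ↦ hb) intervalIntegrable_const
    (.of_forall fun θ _ ↦ hasSum_sqrt_integrand hv θ)
  simp only [intervalIntegral.integral_const_mul, integral_cos_two_mul_sub] at h
  have h2 := h.mul_left (2 / Real.pi)
  have hd : Function.Injective fun n : ℕ ↦ (n, n) := fun a b hab ↦ (Prod.mk.inj hab).1
  rw [← hd.hasSum_iff] at h2
  · rw [toaderMean]
    convert! h2 using 2 with n
    simp
    field_simp
    ring
  · rintro ⟨m, n⟩ hmn
    have : m ≠ n := fun e ↦ hmn ⟨m, by simp [e]⟩
    simp [this]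

theorem continuous_toaderMean_one_add_one_sub :
    Continuous fun v : ℝ ↦ toaderMean (1 + v) (1 - v) := by
  unfold toaderMean
  refine continuous_const.mul
    (intervalIntegral.continuous_parametric_intervalIntegral_of_continuous' ?_ _ _)
  simp only [Function.uncurry_def]
  fun_prop

theorem toaderMean_two_zero : toaderMean (1 + 1) (1 - 1) = 4 / Real.pi := by
  have h : ∫ θ in (0 : ℝ)..(Real.pi / 2),
      Real.sqrt ((1 + 1) ^ 2 * Real.cos θ ^ 2 + (1 - 1) ^ 2 * Real.sin θ ^ 2) =
      ∫ θ in (0 : ℝ)..(Real.pi / 2), 2 * Real.cos θ := by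
    refine intervalIntegral.integral_congr fun θ hθ ↦ ?_
    rw [Set.uIcc_of_le (by positivity)] at hθ
    have hc : 0 ≤ Real.cos θ :=
      Real.cos_nonneg_of_mem_Icc ⟨by linarith [hθ.1, Real.pi_pos], hθ.2⟩
    have : (1 + 1 : ℝ) ^ 2 * Real.cos θ ^ 2 + (1 - 1) ^ 2 * Real.sin θ ^ 2 =
        (2 * Real.cos θ) ^ 2 := by ring
    simp only [this]
    exact Real.sqrt_sq (by positivity)
  rw [toaderMean, h]
  simp
  ring

/-! ### Two-sided bounds for the normalized Toader mean -/

theorem sum_range_three_choose_half (x : ℝ) :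
    ∑ n ∈ Finset.range 3, Ring.choose (1 / 2 : ℝ) n ^ 2 * x ^ n = (1 + x / 8) ^ 2 := by
  simp only [Finset.sum_range_succ, Finset.sum_range_zero, choose_half_two,
    Ring.choose_zero_right, Ring.choose_one_right]
  ring

theorem hasSum_toaderMean_sub {v : ℝ} (hv : v ∈ Set.Ico (0 : ℝ) 1) :
    HasSum (fun n : ℕ ↦ Ring.choose (1 / 2 : ℝ) (n + 3) ^ 2 * (v ^ 2) ^ (n + 3))
      (toaderMean (1 + v) (1 - v) - (1 + v ^ 2 / 8) ^ 2) := by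
  rw [← sum_range_three_choose_half]
  exact (hasSum_nat_add_iff' 3).2 (hasSum_toaderMean hv)

theorem lt_toaderMean {v : ℝ} (hv : v ∈ Set.Ioo (0 : ℝ) 1) :
    (1 + v ^ 2 / 8) ^ 2 < toaderMean (1 + v) (1 - v) := by
  have hv0 := hv.1
  have h := le_hasSum (hasSum_toaderMean_sub ⟨hv.1.le, hv.2⟩) 0 fun n _ ↦ by positivity
  rw [zero_add, choose_half_three] at h
  have : 0 < (1 / 16 : ℝ) ^ 2 * (v ^ 2) ^ 3 := by positivity
  linarith

/-- The remainder of the series after its first three terms is at most `v ^ 6` times its value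
at `v = 1`, all its coefficients being nonnegative. -/
theorem toaderMean_le {v : ℝ} (hv : v ∈ Set.Ico (0 : ℝ) 1) :
    toaderMean (1 + v) (1 - v) ≤ (1 + v ^ 2 / 8) ^ 2 + v ^ 6 * (4 / Real.pi - 81 / 64) := by
  -- The comparison with the value at `w < 1` is termwise; the value at `1` is its limit.
  have key : ∀ w ∈ Set.Ioo (0 : ℝ) 1,
      toaderMean (1 + v * w) (1 - v * w) - (1 + (v * w) ^ 2 / 8) ^ 2 ≤
        v ^ 6 * (toaderMean (1 + w) (1 - w) - (1 + w ^ 2 / 8) ^ 2) := by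
    intro w hw
    have hvw : v * w ∈ Set.Ico (0 : ℝ) 1 :=
      ⟨mul_nonneg hv.1 hw.1.le, mul_lt_one_of_nonneg_of_lt_one_left hv.1 hv.2 hw.2.le⟩
    refine hasSum_le (fun n ↦ ?_) (hasSum_toaderMean_sub hvw)
      ((hasSum_toaderMean_sub ⟨hw.1.le, hw.2⟩).mul_left (v ^ 6))
    have hp : (v ^ 2) ^ n ≤ 1 := pow_le_one₀ (sq_nonneg v) (pow_le_one₀ hv.1 hv.2.le)
    calc _ = (v ^ 2) ^ n *
          (v ^ 6 * (Ring.choose (1 / 2 : ℝ) (n + 3) ^ 2 * (w ^ 2) ^ (n + 3))) := by ring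
      _ ≤ _ := mul_le_of_le_one_left (by have := hv.1; positivity) hp
  have hc := continuous_toaderMean_one_add_one_sub
  have hmem : Set.Ioo (0 : ℝ) 1 ∈ nhdsWithin 1 (Set.Iio 1) := Ioo_mem_nhdsLT one_pos
  have hl : Continuous fun w : ℝ ↦
      toaderMean (1 + v * w) (1 - v * w) - (1 + (v * w) ^ 2 / 8) ^ 2 :=
    (hc.comp (continuous_const.mul continuous_id)).sub (by fun_prop)
  have hr : Continuous fun w : ℝ ↦
      v ^ 6 * (toaderMean (1 + w) (1 - w) - (1 + w ^ 2 / 8) ^ 2) :=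
    continuous_const.mul (hc.sub (by fun_prop))
  have h := le_of_tendsto_of_tendsto ((hl.tendsto 1).mono_left nhdsWithin_le_nhds)
    ((hr.tendsto 1).mono_left nhdsWithin_le_nhds) (Filter.mem_of_superset hmem key)
  rw [toaderMean_two_zero] at h
  norm_num at h
  linarith

/-- In terms of `x = v ^ 2`, the square root of the normalized Toader mean lies strictly below the
chord joining its values at `x = 0` and `x = 1`. -/
theorem toaderMean_lt_chord_sq {v : ℝ} (hv : v ∈ Set.Ioo (0 : ℝ) 1) :
    toaderMean (1 + v) (1 - v) < (1 + v ^ 2 * (Real.sqrt (4 / Real.pi) - 1)) ^ 2 := by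
  refine (toaderMean_le ⟨hv.1.le, hv.2⟩).trans_lt ?_
  have hw2 : Real.sqrt (4 / Real.pi) ^ 2 = 4 / Real.pi := Real.sq_sqrt (by positivity)
  have hw : 9 / 8 < Real.sqrt (4 / Real.pi) := by
    refine Real.lt_sqrt_of_sq_lt ?_
    rw [lt_div_iff₀ Real.pi_pos]
    linarith [Real.pi_lt_d2]
  generalize Real.sqrt (4 / Real.pi) = w at hw hw2 ⊢
  rw [← hw2]
  obtain ⟨x, hx⟩ : ∃ x, x = v ^ 2 := ⟨_, rfl⟩
  have hx0 : 0 < x := by rw [hx]; exact pow_pos hv.1 2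
  have hx1 : x < 1 := by rw [hx]; exact pow_lt_one₀ hv.1.le hv.2 two_ne_zero
  rw [show v ^ 6 = x ^ 3 by rw [hx]; ring, ← hx]
  -- The difference of the two sides factors.
  have : 0 < x * (w - 9 / 8) * (1 - x) * (2 + x * (w + 9 / 8)) :=
    mul_pos (mul_pos (mul_pos hx0 (by linarith)) (by linarith)) (by nlinarith)
  nlinarith [this]

/-! ### Sharp constants for the normalized inequalities -/

/-- The sharp lower bound: `u ≤ 1 / (4 p)` is necessary by the expansion at `v = 0` and sufficient
by Bernoulli's inequality with exponent `p / 2`. -/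
theorem forall_rpow_lt_toaderMean_iff {p u : ℝ} (hp0 : 0 < p) (hp2 : p ≤ 2) (hu : 0 ≤ u) :
    (∀ v ∈ Set.Ioo (0 : ℝ) 1, (1 + u * v ^ 2) ^ p < toaderMean (1 + v) (1 - v)) ↔
      u ≤ 1 / (4 * p) := by
  constructor
  · intro h
    -- Compare the derivatives at `0` of both sides as functions of `x = v ^ 2`.
    have hd : HasDerivAt (fun x : ℝ ↦ (1 + u * x) ^ p) (u * p) 0 := by
      have h1 : HasDerivAt (fun x : ℝ ↦ 1 + u * x) u 0 := by
        simpa using ((hasDerivAt_id (0 : ℝ)).const_mul u).const_add 1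
      simpa using h1.rpow_const (p := p) (by simp)
    have hpi : 4 / Real.pi < 2 := by
      rw [div_lt_iff₀ Real.pi_pos]; linarith [Real.pi_gt_three]
    have hle : u * p ≤ 1 / 4 := by
      have ht := hd.tendsto_slope_zero_right
      have hlim : Filter.Tendsto (fun x : ℝ ↦ 1 / 4 + x) (nhdsWithin 0 (Set.Ioi 0))
          (nhds (1 / 4)) := by
        have : Continuous fun x : ℝ ↦ 1 / 4 + x := by fun_prop
        simpa using (this.tendsto 0).mono_left nhdsWithin_le_nhds
      refine le_of_tendsto_of_tendsto ht hlim
        (Filter.mem_of_superset (Ioo_mem_nhdsGT one_pos) fun x hx ↦ ?_)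
      have hx0 := hx.1
      have hv : Real.sqrt x ∈ Set.Ioo (0 : ℝ) 1 :=
        ⟨Real.sqrt_pos.2 hx.1, (Real.sqrt_lt' one_pos).2 (by simpa using hx.2)⟩
      have hsq : Real.sqrt x ^ 2 = x := Real.sq_sqrt hx.1.le
      have h1 := (h _ hv).trans_le (toaderMean_le ⟨hv.1.le, hv.2⟩)
      rw [show Real.sqrt x ^ 6 = (Real.sqrt x ^ 2) ^ 3 by ring, hsq] at h1
      -- `4 / π - 81 / 64` is at most `2 - 81 / 64 = 47 / 64`.
      have h3 : x ^ 3 * (4 / Real.pi - 81 / 64) ≤ x ^ 2 * (47 / 64) := by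
        have : x ^ 3 ≤ x ^ 2 := pow_le_pow_of_le_one hx.1.le hx.2.le (by norm_num)
        have : x ^ 3 * (4 / Real.pi - 81 / 64) ≤ x ^ 3 * (47 / 64) :=
          mul_le_mul_of_nonneg_left (by linarith) (by positivity)
        linarith
      simp only [Set.mem_ofPred_eq, zero_add, smul_eq_mul, mul_zero, add_zero, Real.one_rpow]
      rw [inv_mul_le_iff₀ hx0]
      nlinarith [sq_nonneg x]
    rw [le_div_iff₀ (by positivity)]
    linarith
  · intro h v hv
    refine lt_of_le_of_lt ?_ (lt_toaderMean hv)
    have hup : u * p ≤ 1 / 4 := by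
      rw [le_div_iff₀ (by positivity)] at h
      linarith
    have hx : 0 ≤ u * v ^ 2 := by positivity
    have hb : (1 + u * v ^ 2) ^ (p / 2) ≤ 1 + v ^ 2 / 8 := by
      refine (rpow_one_add_le_one_add_mul_self (by linarith) (by positivity) (by linarith)).trans ?_
      nlinarith [sq_nonneg v]
    calc (1 + u * v ^ 2) ^ p = ((1 + u * v ^ 2) ^ (p / 2)) ^ 2 := by
          rw [← Real.rpow_mul_natCast (by positivity)]
          norm_num
      _ ≤ _ := by gcongr

/-- The sharp upper bound: equality of both sides at `v = 1` determines the least possible `u`. -/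
theorem forall_toaderMean_lt_rpow_iff {p u : ℝ} (hp0 : 0 < p) (hp2 : p ≤ 2) (hu : 0 ≤ u) :
    (∀ v ∈ Set.Ioo (0 : ℝ) 1, toaderMean (1 + v) (1 - v) < (1 + u * v ^ 2) ^ p) ↔
      (4 / Real.pi) ^ (1 / p) - 1 ≤ u := by
  have hpi : 0 < 4 / Real.pi := by positivity
  constructor
  · intro h
    have hr : Continuous fun v : ℝ ↦ (1 + u * v ^ 2) ^ p :=
      (by fun_prop : Continuous fun v : ℝ ↦ 1 + u * v ^ 2).rpow_const fun _ ↦ Or.inr hp0.le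
    have h1 := le_of_tendsto_of_tendsto
      ((continuous_toaderMean_one_add_one_sub.tendsto 1).mono_left nhdsWithin_le_nhds)
      ((hr.tendsto 1).mono_left nhdsWithin_le_nhds)
      (Filter.mem_of_superset (Ioo_mem_nhdsLT (zero_lt_one (α := ℝ))) fun v hv ↦ (h v hv).le)
    rw [toaderMean_two_zero] at h1
    have h2 := Real.rpow_le_rpow hpi.le h1 (by positivity : 0 ≤ 1 / p)
    rw [← Real.rpow_mul (by positivity), mul_one_div_cancel hp0.ne', Real.rpow_one] at h2
    linarith
  · intro h v hv
    refine (toaderMean_lt_chord_sq hv).trans_le ?_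
    set w := Real.sqrt (4 / Real.pi) with hw
    have hw0 : 0 ≤ w := Real.sqrt_nonneg _
    have hx0 : 0 ≤ v ^ 2 := sq_nonneg v
    have hx1 : v ^ 2 ≤ 1 := pow_le_one₀ hv.1.le hv.2.le
    have hbase : 0 ≤ 1 + v ^ 2 * (w - 1) := by nlinarith
    have hwp : w ^ (2 / p) = (4 / Real.pi) ^ (1 / p) := by
      rw [hw, Real.sqrt_eq_rpow, ← Real.rpow_mul hpi.le]
      congr 1
      field_simp
    -- `2 / p ≥ 1`, so the chord stays above the graph after taking the power `2 / p`.
    have hconv := (convexOn_rpow (p := 2 / p) ((one_le_div hp0).2 hp2)).2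
      (Set.mem_Ici.2 zero_le_one) (Set.mem_Ici.2 hw0) (sub_nonneg.2 hx1) hx0 (by ring)
    simp only [smul_eq_mul, Real.one_rpow, hwp] at hconv
    calc (1 + v ^ 2 * (w - 1)) ^ 2 = ((1 + v ^ 2 * (w - 1)) ^ (2 / p)) ^ p := by
          rw [← Real.rpow_mul hbase, div_mul_cancel₀ _ hp0.ne']
          norm_num
      _ ≤ (1 + u * v ^ 2) ^ p := by
          refine Real.rpow_le_rpow (Real.rpow_nonneg hbase _) ?_ hp0.le
          rw [show 1 + v ^ 2 * (w - 1) = (1 - v ^ 2) * 1 + v ^ 2 * w by ring]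
          nlinarith

/-! ### Reduction to the normalized inequalities -/

theorem toaderMean_mul {c : ℝ} (hc : 0 ≤ c) (a b : ℝ) :
    toaderMean (c * a) (c * b) = c * toaderMean a b := by
  have : ∀ θ, Real.sqrt ((c * a) ^ 2 * Real.cos θ ^ 2 + (c * b) ^ 2 * Real.sin θ ^ 2) =
      c * Real.sqrt (a ^ 2 * Real.cos θ ^ 2 + b ^ 2 * Real.sin θ ^ 2) := fun θ ↦ by
    rw [show (c * a) ^ 2 * Real.cos θ ^ 2 + (c * b) ^ 2 * Real.sin θ ^ 2 =
      c ^ 2 * (a ^ 2 * Real.cos θ ^ 2 + b ^ 2 * Real.sin θ ^ 2) by ring,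
      Real.sqrt_mul (sq_nonneg c), Real.sqrt_sq hc]
  simp only [toaderMean, this, intervalIntegral.integral_const_mul]
  ring

theorem toaderMean_comm (a b : ℝ) : toaderMean a b = toaderMean b a := by
  have h := intervalIntegral.integral_comp_sub_left
    (fun θ ↦ Real.sqrt (a ^ 2 * Real.cos θ ^ 2 + b ^ 2 * Real.sin θ ^ 2)) (Real.pi / 2)
    (a := 0) (b := Real.pi / 2)
  simp only [Real.cos_pi_div_two_sub, Real.sin_pi_div_two_sub, sub_self, sub_zero] at h
  simp only [toaderMean, ← h, add_comm]

theorem toaderBound_comm (p t a b : ℝ) : toaderBound p t a b = toaderBound p t b a := by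
  simp only [toaderBound, contraharmonicMean, arithMean]
  ring_nf

theorem toaderBound_mul {p t c v : ℝ} (hc : 0 < c) :
    toaderBound p t (c * (1 + v)) (c * (1 - v)) = c * (1 + (2 * t - 1) ^ 2 * v ^ 2) ^ p := by
  have h1 : contraharmonicMean (t * (c * (1 + v)) + (1 - t) * (c * (1 - v)))
      (t * (c * (1 - v)) + (1 - t) * (c * (1 + v))) = c * (1 + (2 * t - 1) ^ 2 * v ^ 2) := by
    rw [contraharmonicMean, show t * (c * (1 + v)) + (1 - t) * (c * (1 - v)) +
      (t * (c * (1 - v)) + (1 - t) * (c * (1 + v))) = 2 * c by ring, div_eq_iff (by positivity)]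
    ring
  have h2 : arithMean (c * (1 + v)) (c * (1 - v)) = c := by rw [arithMean]; ring
  rw [toaderBound, h1, h2, Real.mul_rpow hc.le (by positivity), mul_right_comm,
    ← Real.rpow_add hc, add_sub_cancel, Real.rpow_one]

theorem exists_eq_mul_one_add {a b : ℝ} (hb : 0 < b) (hab : b < a) :
    ∃ c > 0, ∃ v ∈ Set.Ioo (0 : ℝ) 1, a = c * (1 + v) ∧ b = c * (1 - v) := by
  have : 0 < a + b := by linarith
  refine ⟨(a + b) / 2, by positivity, (a - b) / (a + b),
    ⟨div_pos (by linarith) this, (div_lt_one this).2 (by linarith)⟩, ?_, ?_⟩ <;>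
  · field_simp
    ring

/-- Reduction to the pairs `(1 + v, 1 - v)` of any comparison `R` invariant under positive scaling;
`R` is meant to be `<` or `>`. -/
theorem forall_toader_iff (p t : ℝ) {R : ℝ → ℝ → Prop}
    (hR : ∀ c > 0, ∀ x y, R (c * x) (c * y) ↔ R x y) :
    (∀ a b : ℝ, 0 < a → 0 < b → a ≠ b → R (toaderBound p t a b) (toaderMean a b)) ↔
      ∀ v ∈ Set.Ioo (0 : ℝ) 1,
        R ((1 + (2 * t - 1) ^ 2 * v ^ 2) ^ p) (toaderMean (1 + v) (1 - v)) := by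
  constructor
  · intro h v hv
    have := h (1 * (1 + v)) (1 * (1 - v)) (by linarith [hv.1]) (by linarith [hv.2])
      (by linarith [hv.1] : _ > _).ne'
    rwa [toaderBound_mul one_pos, one_mul, one_mul, one_mul] at this
  · intro h
    have key : ∀ a b : ℝ, 0 < b → b < a → R (toaderBound p t a b) (toaderMean a b) := by
      intro a b hb hab
      obtain ⟨c, hc, v, hv, rfl, rfl⟩ := exists_eq_mul_one_add hb hab
      rw [toaderBound_mul hc, toaderMean_mul hc.le, hR c hc]
      exact h v hv
    intro a b ha hb hab
    rcases hab.lt_or_gt with h' | h'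
    · rw [toaderBound_comm, toaderMean_comm]
      exact key b a ha h'
    · exact key a b hb h'

theorem complModulus_mem_Ioo {r : ℝ} (hr : r ∈ Set.Ioo (0 : ℝ) 1) :
    complModulus r ∈ Set.Ioo (0 : ℝ) 1 := by
  have h0 := hr.1
  have h1 : r ^ 2 < 1 := pow_lt_one₀ hr.1.le hr.2 two_ne_zero
  refine ⟨Real.sqrt_pos.2 (by linarith), (Real.sqrt_lt' one_pos).2 ?_⟩
  have : 0 < r ^ 2 := by positivity
  linarith

theorem complModulus_complModulus {s : ℝ} (hs : s ∈ Set.Ioo (0 : ℝ) 1) :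
    complModulus (complModulus s) = s := by
  have h1 : s ^ 2 < 1 := pow_lt_one₀ hs.1.le hs.2 two_ne_zero
  rw [complModulus, complModulus, Real.sq_sqrt (by linarith), sub_sub_cancel, Real.sqrt_sq hs.1.le]

theorem ellipticE_eq_toaderMean {r : ℝ} (hr : r ∈ Set.Ioo (0 : ℝ) 1) :
    ellipticE r = Real.pi / 2 * toaderMean 1 (complModulus r) := by
  have h1 : r ^ 2 < 1 := pow_lt_one₀ hr.1.le hr.2 two_ne_zero
  rw [toaderMean, ← mul_assoc, div_mul_div_cancel₀ two_ne_zero, div_self Real.pi_ne_zero, one_mul,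
    ellipticE]
  refine intervalIntegral.integral_congr fun θ _ ↦ ?_
  simp only [complModulus, Real.sq_sqrt (by linarith : (0 : ℝ) ≤ 1 - r ^ 2)]
  congr 1
  linear_combination -Real.sin_sq_add_cos_sq θ

theorem ellipticBound_eq_toaderBound (p t : ℝ) {r : ℝ} (hr : r ∈ Set.Ioo (0 : ℝ) 1) :
    ellipticBound p t r = Real.pi / 2 * toaderBound p t 1 (complModulus r) := by
  have hs := (complModulus_mem_Ioo hr).1
  rw [ellipticBound, toaderBound, contraharmonicMean, arithMean]
  generalize complModulus r = s at hs
  have h1 : 0 < 1 + s := by linarith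
  rw [show t * 1 + (1 - t) * s + (t * s + (1 - t) * 1) = 1 + s by ring,
    Real.div_rpow (by positivity) h1.le, Real.div_rpow h1.le two_pos.le,
    show (1 + s) ^ (1 - 2 * p) = (1 + s) ^ (1 - p) / (1 + s) ^ p by
      rw [← Real.rpow_sub h1]; ring_nf,
    show (2 : ℝ) ^ (p - 2) = (2 * 2 ^ (1 - p))⁻¹ by
      rw [show p - 2 = -(1 + (1 - p)) by ring, Real.rpow_neg two_pos.le, Real.rpow_add two_pos,
        Real.rpow_one],
    show t + (1 - t) * s = t * 1 + (1 - t) * s by ring,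
    show 1 - t + t * s = t * s + (1 - t) * 1 by ring]
  field_simp

/-- The comparisons for the elliptic integral are those for the Toader mean of the pairs `(1, r')`,
and every pair is a multiple of such a pair up to order. -/
theorem forall_elliptic_iff (p t : ℝ) {R : ℝ → ℝ → Prop}
    (hR : ∀ c > 0, ∀ x y, R (c * x) (c * y) ↔ R x y) :
    (∀ r ∈ Set.Ioo (0 : ℝ) 1, R (ellipticBound p t r) (ellipticE r)) ↔
      ∀ a b : ℝ, 0 < a → 0 < b → a ≠ b → R (toaderBound p t a b) (toaderMean a b) := by
  constructor
  · intro h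
    rw [forall_toader_iff p t hR]
    intro v hv
    have hv0 := hv.1
    have h1 : 0 < 1 + v := by linarith
    have hs : (1 - v) / (1 + v) ∈ Set.Ioo (0 : ℝ) 1 :=
      ⟨div_pos (by linarith [hv.2]) h1, (div_lt_one h1).2 (by linarith)⟩
    have hr := complModulus_mem_Ioo hs
    have he : toaderBound p t 1 ((1 - v) / (1 + v)) =
        toaderBound p t ((1 + v)⁻¹ * (1 + v)) ((1 + v)⁻¹ * (1 - v)) := by
      rw [inv_mul_cancel₀ h1.ne', div_eq_inv_mul]
    have he' : toaderMean 1 ((1 - v) / (1 + v)) =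
        toaderMean ((1 + v)⁻¹ * (1 + v)) ((1 + v)⁻¹ * (1 - v)) := by
      rw [inv_mul_cancel₀ h1.ne', div_eq_inv_mul]
    have := h _ hr
    rw [ellipticBound_eq_toaderBound p t hr, ellipticE_eq_toaderMean hr,
      hR _ (by positivity), complModulus_complModulus hs,
      he, he', toaderBound_mul (inv_pos.2 h1),
      toaderMean_mul (inv_pos.2 h1).le, hR _ (inv_pos.2 h1)] at this
    exact this
  · intro h r hr
    have hs := complModulus_mem_Ioo hr
    rw [ellipticBound_eq_toaderBound p t hr, ellipticE_eq_toaderMean hr, hR _ (by positivity)]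
    exact h _ _ one_pos hs.1 hs.2.ne'

theorem le_half_add_sqrt_iff {t y : ℝ} (ht : 1 / 2 ≤ t) (hy : 0 ≤ y) :
    t ≤ 1 / 2 + Real.sqrt y / 2 ↔ (2 * t - 1) ^ 2 ≤ y := by
  rw [← Real.le_sqrt (by linarith) hy]
  constructor <;> intro h <;> linarith

theorem half_add_sqrt_le_iff {t y : ℝ} (ht : 1 / 2 ≤ t) :
    1 / 2 + Real.sqrt y / 2 ≤ t ↔ y ≤ (2 * t - 1) ^ 2 := by
  rw [← Real.sqrt_le_left (by linarith)]
  constructor <;> intro h <;> linarith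

theorem theorem1p2 (p t₁ t₂ : ℝ) (hp : p ∈ Set.Icc (1 / 2 : ℝ) 2)
    (ht₁ : t₁ ∈ Set.Icc (1 / 2 : ℝ) 1) (ht₂ : t₂ ∈ Set.Icc (1 / 2 : ℝ) 1) :
    -- the bounds for the elliptic integral: each side separately, then the double inequality
    ((∀ r ∈ Set.Ioo (0 : ℝ) 1, ellipticBound p t₁ r < ellipticE r) ↔
      t₁ ≤ 1 / 2 + Real.sqrt (1 / (4 * p)) / 2) ∧
    ((∀ r ∈ Set.Ioo (0 : ℝ) 1, ellipticE r < ellipticBound p t₂ r) ↔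
      1 / 2 + Real.sqrt ((4 / Real.pi) ^ (1 / p) - 1) / 2 ≤ t₂) ∧
    ((∀ r ∈ Set.Ioo (0 : ℝ) 1,
        ellipticBound p t₁ r < ellipticE r ∧ ellipticE r < ellipticBound p t₂ r) ↔
      t₁ ≤ 1 / 2 + Real.sqrt (1 / (4 * p)) / 2 ∧
        1 / 2 + Real.sqrt ((4 / Real.pi) ^ (1 / p) - 1) / 2 ≤ t₂) ∧
    -- the bounds for the Toader mean: each side separately, then the double inequality
    ((∀ a b : ℝ, 0 < a → 0 < b → a ≠ b → toaderBound p t₁ a b < toaderMean a b) ↔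
      t₁ ≤ 1 / 2 + Real.sqrt (1 / (4 * p)) / 2) ∧
    ((∀ a b : ℝ, 0 < a → 0 < b → a ≠ b → toaderMean a b < toaderBound p t₂ a b) ↔
      1 / 2 + Real.sqrt ((4 / Real.pi) ^ (1 / p) - 1) / 2 ≤ t₂) ∧
    ((∀ a b : ℝ, 0 < a → 0 < b → a ≠ b →
        toaderBound p t₁ a b < toaderMean a b ∧ toaderMean a b < toaderBound p t₂ a b) ↔
      t₁ ≤ 1 / 2 + Real.sqrt (1 / (4 * p)) / 2 ∧
        1 / 2 + Real.sqrt ((4 / Real.pi) ^ (1 / p) - 1) / 2 ≤ t₂) := by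
  have hp0 : 0 < p := by linarith [hp.1]
  have hlo : (∀ a b : ℝ, 0 < a → 0 < b → a ≠ b → toaderBound p t₁ a b < toaderMean a b) ↔
      t₁ ≤ 1 / 2 + Real.sqrt (1 / (4 * p)) / 2 := by
    rw [forall_toader_iff p t₁ (R := fun x y ↦ x < y) fun c hc x y ↦ mul_lt_mul_iff_right₀ hc,
      forall_rpow_lt_toaderMean_iff hp0 hp.2 (sq_nonneg _),
      le_half_add_sqrt_iff ht₁.1 (by positivity)]
  have hup : (∀ a b : ℝ, 0 < a → 0 < b → a ≠ b → toaderMean a b < toaderBound p t₂ a b) ↔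
      1 / 2 + Real.sqrt ((4 / Real.pi) ^ (1 / p) - 1) / 2 ≤ t₂ := by
    rw [forall_toader_iff p t₂ (R := fun x y ↦ y < x) fun c hc x y ↦ mul_lt_mul_iff_right₀ hc,
      forall_toaderMean_lt_rpow_iff hp0 hp.2 (sq_nonneg _), half_add_sqrt_le_iff ht₂.1]
  have hloE := (forall_elliptic_iff p t₁ (R := fun x y ↦ x < y) fun c hc x y ↦
    mul_lt_mul_iff_right₀ hc).trans hlo
  have hupE := (forall_elliptic_iff p t₂ (R := fun x y ↦ y < x) fun c hc x y ↦
    mul_lt_mul_iff_right₀ hc).trans hup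
  refine ⟨hloE, hupE, ?_, hlo, hup, ?_⟩
  · rw [← hloE, ← hupE]
    exact ⟨fun h ↦ ⟨fun r hr ↦ (h r hr).1, fun r hr ↦ (h r hr).2⟩,
      fun h r hr ↦ ⟨h.1 r hr, h.2 r hr⟩⟩
  · rw [← hlo, ← hup]
    exact ⟨fun h ↦ ⟨fun a b ha hb hab ↦ (h a b ha hb hab).1, fun a b ha hb hab ↦
      (h a b ha hb hab).2⟩, fun h a b ha hb hab ↦ ⟨h.1 a b ha hb hab, h.2 a b ha hb hab⟩⟩
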